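/- Let $\mathbb{D}$ be the open unit disc and $\mathbb{T}$ the unit circle in $\mathbb{C}$. Let $\mathcal{B}(\mathbb{D})$ be the algebra (under pointwise operations) of all holomorphic functions $f:\mathbb{D}\to\mathbb{C}$ such that $$\|f\|_{\mathcal{B}_0}:=\int_0^1\sup_{|\theta|\le\pi}|f'(re^{i\theta})|\,dr<\infty,$$ with the norm $\|f\|_{\mathcal{B}}:=\sup_{\mathbb{D}}|f|+\|f\|_{\mathcal{B}_0}$. Every such $f$ extends continuously to $\overline{\mathbb{D}}$, and its value at $\zeta\in\mathbb{T}$ is $\lim_{r\to1-}f(r\zeta)$. Let $T$ be a bounded linear operator on a complex Banach space $X$ which is power-bounded, i.e. $\sup_{n\ge0}\|T^n\|<\infty$, and let $\sigma_u(T):=\sigma(T)\cap\mathbb{T}$. Assume that $T$ has a bounded $\mathcal{B}$-calculus, i.e. a bounded algebra homomorphism $f\mapsto f(T)$ from $\mathcal{B}(\mathbb{D})$ to the algebra $L(X)$ of bounded linear operators on $X$ which maps the constant function $1$ to the identity operator and the function $z$ to $T$. Let $f\in\mathcal{B}(\mathbb{D})$, and assume that $f$ vanishes on $\sigma_u(T)$.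 Then $\lim_{n\to\infty}\|T^nf(T)\|=0$. -/

import Mathlib

open Filter Topology
open scoped ENNReal Complex.UnitDisc

noncomputable section

namespace AnalyticBesov

/-- A function on the open unit disc, extended by `0` to the plane, so that Mathlib's complex
derivative can be used. Only values and derivatives at points of the open disc are ever used. -/
def toPlane (f : 𝔻 → ℂ) (z : ℂ) : ℂ :=
  if h : ‖z‖ < 1 then f (Complex.UnitDisc.mk z h) else 0

/-- `∫₀¹ sup_{|θ| ≤ π} |F'(r e^{iθ})| dr`, as a value in `[0, ∞]`. -/
def seminormE (F : ℂ → ℂ) : ℝ≥0∞ :=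
  ∫⁻ r in Set.Ioo (0 : ℝ) 1,
    ⨆ θ ∈ Set.Icc (-Real.pi) Real.pi, ‖deriv F (r * Complex.exp (θ * Complex.I))‖ₑ

/-- `f` is holomorphic on the open unit disc with `∫₀¹ sup_{|θ| ≤ π} |f'(r e^{iθ})| dr < ∞`. -/
def IsBesov (f : 𝔻 → ℂ) : Prop :=
  DifferentiableOn ℂ (toPlane f) (Metric.ball 0 1) ∧ seminormE (toPlane f) < ∞

lemma toPlane_coe (f : 𝔻 → ℂ) (z : 𝔻) : toPlane f z = f z := by
  simp [toPlane, z.norm_lt_one]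

lemma toPlane_add (f g : 𝔻 → ℂ) : toPlane (f + g) = toPlane f + toPlane g := by
  ext z
  by_cases h : ‖z‖ < 1 <;> simp [toPlane, h]

lemma toPlane_mul (f g : 𝔻 → ℂ) : toPlane (f * g) = toPlane f * toPlane g := by
  ext z
  by_cases h : ‖z‖ < 1 <;> simp [toPlane, h]

lemma norm_polar {r : ℝ} (hr : r ∈ Set.Ioo (0 : ℝ) 1) (θ : ℝ) :
    ‖(r : ℂ) * Complex.exp (θ * Complex.I)‖ = r := by
  rw [norm_mul, Complex.norm_exp_ofReal_mul_I, mul_one, Complex.norm_real,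
    Real.norm_of_nonneg hr.1.le]

lemma polar_mem {r : ℝ} (hr : r ∈ Set.Ioo (0 : ℝ) 1) (θ : ℝ) :
    (r : ℂ) * Complex.exp (θ * Complex.I) ∈ Metric.ball (0 : ℂ) 1 := by
  rw [mem_ball_zero_iff, norm_polar hr]
  exact hr.2

lemma toPlane_eventuallyEq (F : ℂ → ℂ) {z : ℂ} (hz : z ∈ Metric.ball (0 : ℂ) 1) :
    toPlane (fun w => F w) =ᶠ[𝓝 z] F := by
  filter_upwards [Metric.isOpen_ball.mem_nhds hz] with w hw
  simp [toPlane, mem_ball_zero_iff.1 hw]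

lemma deriv_continuousOn {F : ℂ → ℂ} (hF : DifferentiableOn ℂ F (Metric.ball 0 1)) :
    ContinuousOn (deriv F) (Metric.ball 0 1) :=
  (hF.deriv Metric.isOpen_ball).continuousOn

lemma aemeasurable_sup {F : ℂ → ℂ} (hF : DifferentiableOn ℂ F (Metric.ball 0 1)) :
    AEMeasurable (fun r : ℝ => ⨆ θ ∈ Set.Icc (-Real.pi) Real.pi,
      ‖deriv F (r * Complex.exp (θ * Complex.I))‖ₑ)
      (MeasureTheory.volume.restrict (Set.Ioo (0 : ℝ) 1)) := by
  refine aemeasurable_restrict_of_measurable_subtype measurableSet_Ioo ?_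
  refine LowerSemicontinuous.measurable ?_
  refine lowerSemicontinuous_biSup fun θ _ => Continuous.lowerSemicontinuous ?_
  refine Continuous.enorm ?_
  refine (deriv_continuousOn hF).comp_continuous (by fun_prop) ?_
  intro r
  exact polar_mem r.2 θ

lemma seminormE_congr_le {F : ℂ → ℂ} {c : ℝ≥0∞}
    (h : ∀ z ∈ Metric.ball (0 : ℂ) 1, ‖deriv F z‖ₑ ≤ c) : seminormE F ≤ c := by
  calc seminormE F ≤ ∫⁻ _ in Set.Ioo (0 : ℝ) 1, c := by
        refine MeasureTheory.setLIntegral_mono' measurableSet_Ioo fun r hr => ?_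
        exact iSup₂_le fun θ _ => h _ (polar_mem hr θ)
    _ = c := by simp

/-- The seminorm controls the oscillation of a holomorphic function on the disc. -/
lemma enorm_sub_le {F : ℂ → ℂ} (hF : DifferentiableOn ℂ F (Metric.ball 0 1)) {z : ℂ}
    (hz : ‖z‖ < 1) : ‖F z - F 0‖ₑ ≤ seminormE F := by
  set u : ℂ := Complex.exp (z.arg * Complex.I) with hu
  have hzu : (‖z‖ : ℂ) * u = z := Complex.norm_mul_exp_arg_mul_I z
  have hun : ‖u‖ = 1 := Complex.norm_exp_ofReal_mul_I _
  have hmem : ∀ t ∈ Set.uIcc 0 ‖z‖, (t : ℂ) * u ∈ Metric.ball (0 : ℂ) 1 := by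
    intro t ht
    rw [Set.uIcc_of_le (norm_nonneg z)] at ht
    rw [mem_ball_zero_iff, norm_mul, hun, mul_one, Complex.norm_real, Real.norm_of_nonneg ht.1]
    exact ht.2.trans_lt hz
  have hder : ∀ t ∈ Set.uIcc 0 ‖z‖,
      HasDerivAt (fun t : ℝ => F (t * u)) (deriv F (t * u) * u) t := by
    intro t ht
    have h1 : HasDerivAt F (deriv F (t * u)) ((t : ℂ) * u) :=
      (hF.differentiableAt (Metric.isOpen_ball.mem_nhds (hmem t ht))).hasDerivAt
    have h2 : HasDerivAt (fun s : ℂ => s * u) u (t : ℂ) := by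
      simpa using (hasDerivAt_id (t : ℂ)).mul_const u
    exact (h1.comp (t : ℂ) h2).comp_ofReal
  have hcont : ContinuousOn (fun t : ℝ => deriv F (t * u) * u) (Set.uIcc 0 ‖z‖) := by
    refine ContinuousOn.mul ?_ continuousOn_const
    exact (deriv_continuousOn hF).comp (by fun_prop) hmem
  have hint := intervalIntegral.integral_eq_sub_of_hasDerivAt hder hcont.intervalIntegrable
  simp only [hzu, Complex.ofReal_zero, zero_mul] at hint
  rw [← hint, intervalIntegral.integral_of_le (norm_nonneg z)]
  refine (MeasureTheory.enorm_integral_le_lintegral_enorm _).trans ?_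
  rw [seminormE]
  have hsub : Set.Ioc 0 ‖z‖ ⊆ Set.Ioo (0 : ℝ) 1 := fun t ht => ⟨ht.1, ht.2.trans_lt hz⟩
  refine le_trans (MeasureTheory.lintegral_mono fun t => ?_)
    (MeasureTheory.lintegral_mono_set hsub)
  have hu1 : ‖u‖ₑ = 1 := by rw [← ofReal_norm, hun, ENNReal.ofReal_one]
  simp only [enorm_mul, hu1, mul_one]
  exact le_iSup₂ (f := fun (θ : ℝ) (_ : θ ∈ Set.Icc (-Real.pi) Real.pi) =>
    ‖deriv F (t * Complex.exp (θ * Complex.I))‖ₑ) z.arg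
    ⟨(Complex.neg_pi_lt_arg z).le, Complex.arg_le_pi z⟩

lemma enorm_le {F : ℂ → ℂ} (hF : DifferentiableOn ℂ F (Metric.ball 0 1)) {z : ℂ}
    (hz : z ∈ Metric.ball (0 : ℂ) 1) : ‖F z‖ₑ ≤ seminormE F + ‖F 0‖ₑ := by
  calc ‖F z‖ₑ = ‖(F z - F 0) + F 0‖ₑ := by rw [sub_add_cancel]
    _ ≤ ‖F z - F 0‖ₑ + ‖F 0‖ₑ := enorm_add_le _ _
    _ ≤ _ := by gcongr; exact enorm_sub_le hF (mem_ball_zero_iff.1 hz)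

/-- Functions in the analytic Besov space are bounded. -/
lemma IsBesov.bddAbove {f : 𝔻 → ℂ} (hf : IsBesov f) :
    BddAbove (Set.range fun z : 𝔻 => ‖f z‖) := by
  have hfin : seminormE (toPlane f) + ‖toPlane f 0‖ₑ ≠ ∞ :=
    ENNReal.add_ne_top.2 ⟨hf.2.ne, enorm_ne_top⟩
  refine ⟨(seminormE (toPlane f) + ‖toPlane f 0‖ₑ).toReal, ?_⟩
  rintro _ ⟨z, rfl⟩
  have h := enorm_le hf.1 (mem_ball_zero_iff.2 z.norm_lt_one)
  rw [toPlane_coe] at h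
  simpa using ENNReal.toReal_mono hfin h

lemma IsBesov.add {f g : 𝔻 → ℂ} (hf : IsBesov f) (hg : IsBesov g) : IsBesov (f + g) := by
  rw [IsBesov, toPlane_add]
  refine ⟨hf.1.add hg.1, ?_⟩
  refine lt_of_le_of_lt ?_ (ENNReal.add_lt_top.2 ⟨hf.2, hg.2⟩)
  rw [seminormE, seminormE, seminormE, ← MeasureTheory.lintegral_add_left' (aemeasurable_sup hf.1)]
  refine MeasureTheory.setLIntegral_mono' measurableSet_Ioo fun r hr => ?_
  refine iSup₂_le fun θ hθ => ?_
  have hm := Metric.isOpen_ball.mem_nhds (polar_mem hr θ)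
  rw [deriv_add (hf.1.differentiableAt hm) (hg.1.differentiableAt hm)]
  exact (enorm_add_le _ _).trans (add_le_add
    (le_iSup₂ (f := fun (θ : ℝ) (_ : θ ∈ Set.Icc (-Real.pi) Real.pi) =>
      ‖deriv (toPlane f) (r * Complex.exp (θ * Complex.I))‖ₑ) θ hθ)
    (le_iSup₂ (f := fun (θ : ℝ) (_ : θ ∈ Set.Icc (-Real.pi) Real.pi) =>
      ‖deriv (toPlane g) (r * Complex.exp (θ * Complex.I))‖ₑ) θ hθ))

lemma IsBesov.mul {f g : 𝔻 → ℂ} (hf : IsBesov f) (hg : IsBesov g) : IsBesov (f * g) := by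
  rw [IsBesov, toPlane_mul]
  refine ⟨hf.1.mul hg.1, ?_⟩
  set A := seminormE (toPlane f) + ‖toPlane f 0‖ₑ with hA
  set B := seminormE (toPlane g) + ‖toPlane g 0‖ₑ with hB
  have hAfin : A ≠ ∞ := ENNReal.add_ne_top.2 ⟨hf.2.ne, enorm_ne_top⟩
  have hBfin : B ≠ ∞ := ENNReal.add_ne_top.2 ⟨hg.2.ne, enorm_ne_top⟩
  have hfin : B * seminormE (toPlane f) + A * seminormE (toPlane g) < ∞ :=
    ENNReal.add_lt_top.2 ⟨ENNReal.mul_lt_top hBfin.lt_top hf.2,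
      ENNReal.mul_lt_top hAfin.lt_top hg.2⟩
  refine lt_of_le_of_lt ?_ hfin
  rw [seminormE, seminormE, seminormE, ← MeasureTheory.lintegral_const_mul' _ _ hBfin,
    ← MeasureTheory.lintegral_const_mul' _ _ hAfin,
    ← MeasureTheory.lintegral_add_left' ((aemeasurable_sup hf.1).const_mul B)]
  refine MeasureTheory.setLIntegral_mono' measurableSet_Ioo fun r hr => ?_
  refine iSup₂_le fun θ hθ => ?_
  have hm := Metric.isOpen_ball.mem_nhds (polar_mem hr θ)
  rw [deriv_mul (hf.1.differentiableAt hm) (hg.1.differentiableAt hm)]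
  refine (enorm_add_le _ _).trans (add_le_add ?_ ?_)
  · rw [enorm_mul, mul_comm]
    refine mul_le_mul' (enorm_le hg.1 (polar_mem hr θ)) ?_
    exact le_iSup₂ (f := fun (θ : ℝ) (_ : θ ∈ Set.Icc (-Real.pi) Real.pi) =>
      ‖deriv (toPlane f) (r * Complex.exp (θ * Complex.I))‖ₑ) θ hθ
  · rw [enorm_mul]
    refine mul_le_mul' (enorm_le hf.1 (polar_mem hr θ)) ?_
    exact le_iSup₂ (f := fun (θ : ℝ) (_ : θ ∈ Set.Icc (-Real.pi) Real.pi) =>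
      ‖deriv (toPlane g) (r * Complex.exp (θ * Complex.I))‖ₑ) θ hθ

/-- The restriction to the disc of an entire function with bounded derivative on the disc. -/
lemma isBesov_of_bound {F : ℂ → ℂ} (hF : Differentiable ℂ F) {c : ℝ≥0∞} (hc : c < ∞)
    (h : ∀ z ∈ Metric.ball (0 : ℂ) 1, ‖deriv F z‖ₑ ≤ c) : IsBesov (fun z : 𝔻 => F z) := by
  refine ⟨fun z hz => ?_, lt_of_le_of_lt (seminormE_congr_le fun z hz => ?_) hc⟩
  · exact ((hF z).congr_of_eventuallyEq (toPlane_eventuallyEq F hz)).differentiableWithinAt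
  · rw [(toPlane_eventuallyEq F hz).deriv_eq]
    exact h z hz

lemma isBesov_const (c : ℂ) : IsBesov (fun _ : 𝔻 => c) :=
  isBesov_of_bound (F := fun _ => c) (differentiable_const c) ENNReal.zero_lt_top (by simp)

lemma isBesov_coe : IsBesov (fun z : 𝔻 => (z : ℂ)) :=
  isBesov_of_bound (F := fun z => z) differentiable_id ENNReal.one_lt_top (by simp)

end AnalyticBesov

open AnalyticBesov

/-- The algebra `𝓑(𝔻)` of analytic Besov functions: all holomorphic functions `f` on the open unit
disc with `∫₀¹ sup_{|θ| ≤ π} |f'(r e^{iθ})| dr < ∞`, under the pointwise operations. -/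
def BesovAlgebra : Subalgebra ℂ (𝔻 → ℂ) where
  carrier := {f | IsBesov f}
  mul_mem' := IsBesov.mul
  add_mem' := IsBesov.add
  algebraMap_mem' c := isBesov_const c

/-- The norm `‖f‖_𝓑 = sup_𝔻 |f| + ∫₀¹ sup_{|θ| ≤ π} |f'(r e^{iθ})| dr`. Both terms are finite on
`𝓑(𝔻)`: the first by `IsBesov.bddAbove`, the second by definition. -/
def besovNorm (f : BesovAlgebra) : ℝ :=
  (⨆ z : 𝔻, ‖(f : 𝔻 → ℂ) z‖) + (seminormE (toPlane f)).toReal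

/-- The identity function `z` as an element of `𝓑(𝔻)`. -/
def besovCoord : BesovAlgebra := ⟨fun z => (z : ℂ), isBesov_coe⟩

/-- The radial limit `lim_{r → 1-} f(r ζ)` at the boundary point `ζ` exists and equals `w`. -/
def HasBoundaryValue (f : BesovAlgebra) (ζ w : ℂ) : Prop :=
  Tendsto (fun r : ℝ => toPlane f (r * ζ)) (𝓝[<] 1) (𝓝 w)

/-- A bounded `𝓑`-calculus for `T`: a bounded homomorphism of complex algebras `f ↦ f(T)` from
`𝓑(𝔻)` to `L(X)` that maps the constant function `1` to the identity operator (this is part of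
`→ₐ`) and the function `z` to `T`. -/
structure BoundedBesovCalculus {X : Type*} [NormedAddCommGroup X] [NormedSpace ℂ X]
    (T : X →L[ℂ] X) where
  toAlgHom : BesovAlgebra →ₐ[ℂ] (X →L[ℂ] X)
  map_coord : toAlgHom besovCoord = T
  bounded : ∃ C : ℝ, ∀ f, ‖toAlgHom f‖ ≤ C * besovNorm f

/-- `T` is power-bounded: `sup_n ‖Tⁿ‖ < ∞`. -/
def IsPowerBounded {X : Type*} [NormedAddCommGroup X] [NormedSpace ℂ X] (T : X →L[ℂ] X) : Prop :=
  ∃ K : ℝ, ∀ n : ℕ, ‖T ^ n‖ ≤ K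

/-- The unitary spectrum `σ_u(T)`: the part of the spectrum on the unit circle. -/
def unitarySpectrum {X : Type*} [NormedAddCommGroup X] [NormedSpace ℂ X] (T : X →L[ℂ] X) : Set ℂ :=
  spectrum ℂ T ∩ Metric.sphere 0 1

end

/-!
The proof transfers the question from the Besov algebra to `C(𝕋)` and there uses that a closed ideal
is determined by its zero set.

The norm of `zⁿ f` in `𝓑(𝔻)` is asymptotically at most `2 sup |f|`: the product rule gives a term
bounded by `sup |f| · ∫₀¹ n rⁿ⁻¹ dr = sup |f|` and a term that tends to `0` by dominated
convergence. Hence `limsup ‖Tⁿ f(T)‖ ≤ c sup |f|` for all `f` in `𝓑(𝔻)`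
(`exists_calculus_bound`). By absolute continuity of the integral, dilations `f(r ·)` converge to
`f` uniformly on the disc, so polynomials approximate `f` uniformly
(`exists_polynomial_near_besov`), and it suffices to bound `limsup ‖Tⁿ p(T)‖` by a multiple of
`max |p|` over the unitary spectrum, for polynomials `p` (`AsympBound.of_norm_le_on_spectrum`).

The seminorm `limsup ‖Tⁿ p(T)‖` is submultiplicative, is unchanged if `p` is multiplied by `z`, and
is dominated by `max |p|` over `𝕋`. It therefore extends to Laurent polynomials and to their uniform
limits, that is, to `C(𝕋)` (`CircleBound`), where its null space is a closed ideal (`nullIdeal`). At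
a point `w` of `𝕋` outside the spectrum, a narrow tent function `h` around `w` has small seminorm,
since `(w - z) h` is uniformly small and `w - T` is invertible. If `g` is a tent with `h g = g`, its
seminorm is at most half of itself, so `g` is in the ideal although `g w ≠ 0`
(`exists_mem_nullIdeal_ne_zero`). Thus the ideal contains every function that vanishes on the
unitary spectrum, and a polynomial may be replaced by its truncation to small values.
-/

namespace KatznelsonTzafriri

open AnalyticBesov Polynomial

/-! ### Laurent polynomials on the unit circle -/

/-- Laurent polynomials are dense in `C(𝕋)`, by the Stone-Weierstrass theorem. -/
lemma exists_polynomial_near (g : C(Metric.sphere (0 : ℂ) 1, ℂ)) {ε : ℝ} (hε : 0 < ε) :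
    ∃ (p : ℂ[X]) (k : ℕ),
      ∀ z : Metric.sphere (0 : ℂ) 1, ‖(z : ℂ) ^ k * g z - p.eval (z : ℂ)‖ ≤ ε := by
  have hdense : g ∈ closure ((polynomialFunctions (Metric.sphere (0 : ℂ) 1)).starClosure :
      Set C(Metric.sphere (0 : ℂ) 1, ℂ)) := by
    have h := polynomialFunctions.starClosure_topologicalClosure (Metric.sphere (0 : ℂ) 1)
    rw [← StarSubalgebra.topologicalClosure_coe, h]
    trivial
  obtain ⟨l, hl, hgl⟩ := Metric.mem_closure_iff.1 hdense ε hε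
  have key : ∃ (p : ℂ[X]) (k : ℕ), ∀ z : Metric.sphere (0 : ℂ) 1,
      (z : ℂ) ^ k * l z = p.eval (z : ℂ) := by
    clear hgl
    rw [polynomialFunctions.starClosure_eq_adjoin_X, SetLike.mem_coe,
      ← StarSubalgebra.mem_toSubalgebra, StarAlgebra.adjoin_toSubalgebra] at hl
    induction hl using Algebra.adjoin_induction with
    | mem x hx =>
      rcases hx with hx | hx
      · rw [Set.mem_singleton_iff] at hx
        exact ⟨X, 0, fun z => by simp [hx]⟩
      · rw [Set.mem_star, Set.mem_singleton_iff] at hx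
        refine ⟨1, 1, fun z => ?_⟩
        have hz : x z = star (z : ℂ) := by
          rw [← star_star x, hx]
          simp
        have hn : ‖(z : ℂ)‖ = 1 := by simp
        rw [hz, pow_one, Complex.star_def, Complex.mul_conj, Complex.normSq_eq_norm_sq, hn]
        simp
    | algebraMap r => exact ⟨C r, 0, fun z => by simp⟩
    | add x y _ _ hx hy =>
      obtain ⟨p, k, hp⟩ := hx
      obtain ⟨q, m, hq⟩ := hy
      refine ⟨X ^ m * p + X ^ k * q, k + m, fun z => ?_⟩
      simp only [ContinuousMap.add_apply, eval_add, eval_mul, eval_pow, eval_X, ← hp, ← hq]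
      ring
    | mul x y _ _ hx hy =>
      obtain ⟨p, k, hp⟩ := hx
      obtain ⟨q, m, hq⟩ := hy
      refine ⟨p * q, k + m, fun z => ?_⟩
      simp only [ContinuousMap.mul_apply, eval_mul, ← hp, ← hq]
      ring
  obtain ⟨p, k, hp⟩ := key
  refine ⟨p, k, fun z => ?_⟩
  have hz : ‖(z : ℂ)‖ = 1 := by simp
  rw [← hp, ← mul_sub, norm_mul, norm_pow, hz, one_pow, one_mul, ← dist_eq_norm]
  exact (ContinuousMap.dist_apply_le_dist z).trans hgl.le

/-! ### Asymptotic bounds along the powers of an element of a normed algebra -/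

section Asymptotic

variable {A : Type*} [NormedRing A] [NormedAlgebra ℂ A] {a : A} {c s t : ℝ} {p q : ℂ[X]}

/-- `s` is eventually a bound for `‖aⁿ p(a)‖`. -/
def AsympBound (a : A) (p : ℂ[X]) (s : ℝ) : Prop :=
  ∀ᶠ n : ℕ in atTop, ‖aeval a (X ^ n * p)‖ ≤ s

lemma AsympBound.mono (h : AsympBound a p s) (hst : s ≤ t) : AsympBound a p t :=
  Filter.Eventually.mono h fun _ hn => hn.trans hst

lemma AsympBound.add (hp : AsympBound a p s) (hq : AsympBound a q t) :
    AsympBound a (p + q) (s + t) := by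
  filter_upwards [hp, hq] with n h1 h2
  rw [mul_add, map_add]
  exact (norm_add_le _ _).trans (add_le_add h1 h2)

/-- Half of the power of `a` is spent on each factor. -/
lemma AsympBound.mul (hp : AsympBound a p s) (hq : AsympBound a q t) :
    AsympBound a (p * q) (s * t) := by
  have h1 : Tendsto (fun n : ℕ => n / 2) atTop atTop :=
    Nat.tendsto_div_const_atTop two_ne_zero
  have h2 : Tendsto (fun n : ℕ => n - n / 2) atTop atTop :=
    tendsto_atTop_mono (fun n => by omega) h1
  filter_upwards [h1.eventually hp, h2.eventually hq] with n hn1 hn2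
  have e : (X : ℂ[X]) ^ n * (p * q) = (X ^ (n / 2) * p) * (X ^ (n - n / 2) * q) := by
    have : n / 2 + (n - n / 2) = n := by omega
    conv_lhs => rw [← this, pow_add]
    ring
  rw [e, map_mul]
  exact (norm_mul_le _ _).trans
    (mul_le_mul hn1 hn2 (norm_nonneg _) ((norm_nonneg _).trans hn1))

lemma AsympBound.of_X_pow_mul {k : ℕ} (h : AsympBound a (X ^ k * p) s) : AsympBound a p s := by
  filter_upwards [(tendsto_sub_atTop_nat k).eventually h, eventually_ge_atTop k] with n hn hk
  rwa [← mul_assoc, ← pow_add, Nat.sub_add_cancel hk] at hn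

lemma AsympBound.of_resolvent {b : A} {w : ℂ} (hb : b * (algebraMap ℂ A w - a) = 1)
    (h : AsympBound a ((C w - X) * p) s) : AsympBound a p (‖b‖ * s) := by
  filter_upwards [h] with n hn
  have e : aeval a (X ^ n * p) = b * aeval a (X ^ n * ((C w - X) * p)) := by
    rw [mul_left_comm, map_mul _ (C w - X), map_sub, aeval_C, aeval_X, ← mul_assoc, hb, one_mul]
  rw [e]
  exact (norm_mul_le _ _).trans (mul_le_mul_of_nonneg_left hn (norm_nonneg _))

/-- The asymptotic size of `p(a)` along the powers of `a` is controlled, up to the factor `c`, by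
the maximum of `|p|` on the unit circle. -/
def CircleDominated (a : A) (c : ℝ) : Prop :=
  ∀ (p : ℂ[X]) (δ : ℝ), 0 < δ → (∀ z : Metric.sphere (0 : ℂ) 1, ‖p.eval (z : ℂ)‖ ≤ δ) →
    AsympBound a p (c * δ)

/-- The extension of `AsympBound` from polynomials to continuous functions on the unit circle:
`g` is approximated by Laurent polynomials `p / z ^ k`. The factor `z ^ k` is harmless, since
asymptotic bounds do not change under multiplication by `z`. -/
def CircleBound (a : A) (g : C(Metric.sphere (0 : ℂ) 1, ℂ)) (s : ℝ) : Prop :=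
  ∀ ε > 0, ∃ (p : ℂ[X]) (k : ℕ),
    (∀ z : Metric.sphere (0 : ℂ) 1, ‖(z : ℂ) ^ k * g z - p.eval (z : ℂ)‖ ≤ ε) ∧
      AsympBound a p (s + ε)

variable {g h : C(Metric.sphere (0 : ℂ) 1, ℂ)}

lemma norm_pow_coe_sphere (z : Metric.sphere (0 : ℂ) 1) (k : ℕ) : ‖(z : ℂ) ^ k‖ = 1 := by
  simp

lemma CircleBound.of_norm_le (ha : CircleDominated a c) (hc : 0 ≤ c) {δ : ℝ} (hδ : 0 ≤ δ)
    (hg : ∀ z, ‖g z‖ ≤ δ) : CircleBound a g (c * δ) := by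
  intro ε hε
  have hη : 0 < ε / (c + 1) := by positivity
  obtain ⟨p, k, hp⟩ := exists_polynomial_near g hη
  refine ⟨p, k, fun z => (hp z).trans (div_le_self hε.le (by linarith)), ?_⟩
  refine (ha p (δ + ε / (c + 1)) (by positivity) fun z => ?_).mono ?_
  · calc ‖p.eval (z : ℂ)‖ = ‖(z : ℂ) ^ k * g z - ((z : ℂ) ^ k * g z - p.eval (z : ℂ))‖ := by
          rw [sub_sub_cancel]
      _ ≤ ‖(z : ℂ) ^ k * g z‖ + ‖(z : ℂ) ^ k * g z - p.eval (z : ℂ)‖ := norm_sub_le _ _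
      _ ≤ δ + ε / (c + 1) := by
          rw [norm_mul, norm_pow_coe_sphere, one_mul]
          exact add_le_add (hg z) (hp z)
  · rw [mul_add]
    gcongr
    rw [← mul_div_assoc, div_le_iff₀ (by linarith)]
    nlinarith

lemma CircleBound.add (hg : CircleBound a g s) (hh : CircleBound a h t) :
    CircleBound a (g + h) (s + t) := by
  intro ε hε
  obtain ⟨p, k, hp, hp'⟩ := hg (ε / 2) (by positivity)
  obtain ⟨q, m, hq, hq'⟩ := hh (ε / 2) (by positivity)
  have shift : ∀ {p : ℂ[X]} {s : ℝ} (k : ℕ), AsympBound a p s → AsympBound a (X ^ k * p) s := by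
    intro p s k hb
    filter_upwards [(tendsto_add_atTop_nat k).eventually hb] with n hn
    rwa [pow_add, mul_assoc] at hn
  refine ⟨X ^ m * p + X ^ k * q, k + m, fun z => ?_,
    ((shift m hp').add (shift k hq')).mono (by linarith)⟩
  calc ‖(z : ℂ) ^ (k + m) * (g + h) z - (X ^ m * p + X ^ k * q).eval (z : ℂ)‖
      = ‖(z : ℂ) ^ m * ((z : ℂ) ^ k * g z - p.eval (z : ℂ)) +
          (z : ℂ) ^ k * ((z : ℂ) ^ m * h z - q.eval (z : ℂ))‖ := by
        congr 1
        simp only [ContinuousMap.add_apply, eval_add, eval_mul, eval_pow, eval_X]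
        ring
    _ ≤ ε / 2 + ε / 2 := by
        refine (norm_add_le _ _).trans ?_
        rw [norm_mul, norm_mul, norm_pow_coe_sphere, norm_pow_coe_sphere, one_mul, one_mul]
        exact add_le_add (hp z) (hq z)
    _ = ε := add_halves ε

lemma CircleBound.mul (hg : CircleBound a g s) (hh : CircleBound a h t) (hs : 0 ≤ s)
    (ht : 0 ≤ t) : CircleBound a (g * h) (s * t) := by
  intro ε hε
  set D : ℝ := s + t + ‖g‖ + ‖h‖ + 1 with hD
  have hD0 : 0 < D := by positivity
  -- `η` is small enough for `(s + η) * (t + η) ≤ s * t + ε` and for the error of the product.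
  obtain ⟨η, hη, hη1, hηD⟩ : ∃ η : ℝ, 0 < η ∧ η ≤ 1 ∧ η * D ≤ ε :=
    ⟨min 1 (ε / D), by positivity, min_le_left _ _,
      (mul_le_mul_of_nonneg_right (min_le_right _ _) hD0.le).trans
        (div_mul_cancel₀ ε hD0.ne').le⟩
  obtain ⟨p, k, hp, hp'⟩ := hg η hη
  obtain ⟨q, m, hq, hq'⟩ := hh η hη
  have hng := norm_nonneg g
  have hnh := norm_nonneg h
  refine ⟨p * q, k + m, fun z => ?_, (hp'.mul hq').mono ?_⟩
  · have hgz := g.norm_coe_le_norm z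
    have hpz : ‖p.eval (z : ℂ)‖ ≤ ‖g‖ + 1 := by
      calc ‖p.eval (z : ℂ)‖ = ‖(z : ℂ) ^ k * g z - ((z : ℂ) ^ k * g z - p.eval (z : ℂ))‖ := by
            rw [sub_sub_cancel]
        _ ≤ ‖(z : ℂ) ^ k * g z‖ + ‖(z : ℂ) ^ k * g z - p.eval (z : ℂ)‖ := norm_sub_le _ _
        _ ≤ ‖g‖ + 1 := by
            rw [norm_mul, norm_pow_coe_sphere, one_mul]
            exact add_le_add hgz ((hp z).trans hη1)
    calc ‖(z : ℂ) ^ (k + m) * (g * h) z - (p * q).eval (z : ℂ)‖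
        = ‖((z : ℂ) ^ k * g z - p.eval (z : ℂ)) * ((z : ℂ) ^ m * h z) +
            p.eval (z : ℂ) * ((z : ℂ) ^ m * h z - q.eval (z : ℂ))‖ := by
          congr 1
          simp only [ContinuousMap.mul_apply, eval_mul]
          ring
      _ ≤ η * ‖h‖ + (‖g‖ + 1) * η := by
          refine (norm_add_le _ _).trans ?_
          rw [norm_mul, norm_mul, norm_mul (eval (z : ℂ) p), norm_pow_coe_sphere, one_mul]
          gcongr
          · exact hp z
          · exact h.norm_coe_le_norm z
          · exact hq z
      _ ≤ η * D := by
          rw [hD]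
          nlinarith [mul_nonneg hη.le hs, mul_nonneg hη.le ht]
      _ ≤ ε := hηD
  · have : (s + η) * (t + η) ≤ s * t + η * D := by
      rw [hD]
      nlinarith [mul_nonneg hη.le hng, mul_nonneg hη.le hnh]
    linarith

lemma CircleBound.zero_of_forall (hg : ∀ ε > 0, ∃ s ≤ ε, CircleBound a g s) :
    CircleBound a g 0 := by
  intro ε hε
  obtain ⟨s, hs, hb⟩ := hg (ε / 2) (by positivity)
  obtain ⟨p, k, hp, hp'⟩ := hb (ε / 2) (by positivity)
  exact ⟨p, k, fun z => (hp z).trans (by linarith), hp'.mono (by linarith)⟩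

/-- The closed ideal of the continuous functions on the circle that are asymptotically null. -/
def nullIdeal (ha : CircleDominated a c) (hc : 0 ≤ c) :
    Ideal C(Metric.sphere (0 : ℂ) 1, ℂ) where
  carrier := {g | CircleBound a g 0}
  add_mem' hg hh := by simpa using CircleBound.add hg hh
  zero_mem' := by
    simpa using CircleBound.of_norm_le ha hc le_rfl (g := 0) (by simp)
  smul_mem' h g hg := by
    simpa using (CircleBound.of_norm_le ha hc (norm_nonneg h) h.norm_coe_le_norm).mul hg
      (mul_nonneg hc (norm_nonneg h)) le_rfl

lemma mem_nullIdeal {ha : CircleDominated a c} {hc : 0 ≤ c} :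
    g ∈ nullIdeal ha hc ↔ CircleBound a g 0 := Iff.rfl

lemma isClosed_nullIdeal (ha : CircleDominated a c) (hc : 0 ≤ c) :
    IsClosed (nullIdeal ha hc : Set C(Metric.sphere (0 : ℂ) 1, ℂ)) := by
  refine isClosed_of_closure_subset fun g hg => ?_
  rw [SetLike.mem_coe, mem_nullIdeal]
  refine CircleBound.zero_of_forall fun ε hε => ?_
  have hη : 0 < ε / (c + 1) := by positivity
  obtain ⟨h, hh, hgh⟩ := Metric.mem_closure_iff.1 hg _ hη
  have hsum := CircleBound.add (mem_nullIdeal.1 hh)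
    (CircleBound.of_norm_le ha hc hη.le (g := g - h) fun z => by
      rw [ContinuousMap.sub_apply, ← dist_eq_norm]
      exact (ContinuousMap.dist_apply_le_dist z).trans hgh.le)
  refine ⟨_, ?_, by simpa using hsum⟩
  rw [← mul_div_assoc, div_le_iff₀ (by linarith)]
  nlinarith

/-! ### Localization at the spectrum -/

/-- The tent function on the circle that is `1` on the disc of radius `δ` around `w` and vanishes
outside the disc of radius `2 δ`. -/
noncomputable def tent (w : ℂ) (δ : ℝ) : C(Metric.sphere (0 : ℂ) 1, ℂ) where
  toFun z := ((max 0 (min 1 (2 - ‖w - z‖ / δ)) : ℝ) : ℂ)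

lemma tent_norm_le (w : ℂ) (δ : ℝ) (z : Metric.sphere (0 : ℂ) 1) : ‖tent w δ z‖ ≤ 1 := by
  simp [tent, abs_of_nonneg]

lemma tent_eq_one {w : ℂ} {δ : ℝ} (hδ : 0 < δ) {z : Metric.sphere (0 : ℂ) 1}
    (h : ‖w - z‖ ≤ δ) : tent w δ z = 1 := by
  have : ‖w - z‖ / δ ≤ 1 := (div_le_one hδ).2 h
  simp [tent, min_eq_left (show (1 : ℝ) ≤ 2 - ‖w - z‖ / δ by linarith)]

lemma tent_eq_zero {w : ℂ} {δ : ℝ} (hδ : 0 < δ) {z : Metric.sphere (0 : ℂ) 1}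
    (h : 2 * δ ≤ ‖w - z‖) : tent w δ z = 0 := by
  have : 2 ≤ ‖w - z‖ / δ := (le_div_iff₀ hδ).2 h
  have h2 : min 1 (2 - ‖w - z‖ / δ) ≤ 0 := (min_le_right _ _).trans (by linarith)
  simp [tent, max_eq_left h2]

/-- A narrow tent at a point where `w - a` is invertible has a small asymptotic bound, because
`w - z` is small on its support. -/
lemma circleBound_tent (ha : CircleDominated a c) (hc : 0 ≤ c) {b : A} {w : ℂ}
    (hw : ‖w‖ = 1) (hb : b * (algebraMap ℂ A w - a) = 1) {δ : ℝ} (hδ : 0 < δ) :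
    CircleBound a (tent w δ) (‖b‖ * (c * (2 * δ))) := by
  intro ε hε
  set D : ℝ := ‖b‖ * (c * 2) + 1 with hD
  have hD1 : 1 ≤ D := by
    have : 0 ≤ ‖b‖ * (c * 2) := by positivity
    linarith
  have hD0 : 0 < D := by linarith
  obtain ⟨p, k, hp⟩ := exists_polynomial_near (tent w δ) (ε := ε / D) (by positivity)
  refine ⟨p, k, fun z => (hp z).trans (div_le_self hε.le hD1), ?_⟩
  have hbd := ha ((C w - X) * p) (2 * δ + 2 * (ε / D)) (by positivity) fun z => ?_
  · refine (hbd.of_resolvent hb).mono ?_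
    have : D * (ε / D) = ε := mul_div_cancel₀ ε hD0.ne'
    have h0 : 0 < ε / D := by positivity
    rw [hD] at this
    nlinarith
  · have hz : ‖w - (z : ℂ)‖ ≤ 2 := by
      refine (norm_sub_le _ _).trans ?_
      rw [hw, mem_sphere_zero_iff_norm.1 z.2]
      norm_num
    have htent : ‖(w - z) * tent w δ z‖ ≤ 2 * δ := by
      rcases le_total (2 * δ) ‖w - (z : ℂ)‖ with h | h
      · rw [tent_eq_zero hδ h, mul_zero, norm_zero]
        positivity
      · rw [norm_mul]
        calc _ ≤ 2 * δ * 1 := by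
              gcongr
              exact tent_norm_le w δ z
          _ = 2 * δ := mul_one _
    have e : ((C w - X) * p).eval (z : ℂ) = (z : ℂ) ^ k * ((w - z) * tent w δ z) -
        (w - z) * ((z : ℂ) ^ k * tent w δ z - p.eval (z : ℂ)) := by
      simp only [eval_mul, eval_sub, eval_C, eval_X]
      ring
    rw [e]
    refine (norm_sub_le _ _).trans ?_
    rw [norm_mul, norm_pow_coe_sphere, one_mul, norm_mul _ ((z : ℂ) ^ k * _ - _)]
    exact add_le_add htent (mul_le_mul hz (hp z) (norm_nonneg _) zero_le_two)

/-- Off the spectrum, some asymptotically null function does not vanish: if `h` is a tent with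
asymptotic bound `1 / 2` and `g` a tent with `h * g = g`, then every asymptotic bound of `g` can be
halved. -/
lemma exists_mem_nullIdeal_ne_zero (ha : CircleDominated a c) (hc : 0 ≤ c)
    (w : Metric.sphere (0 : ℂ) 1) (hw : (w : ℂ) ∉ spectrum ℂ a) :
    ∃ g ∈ nullIdeal ha hc, g w ≠ 0 := by
  obtain ⟨u, hu⟩ := spectrum.notMem_iff.1 hw
  have hb : (↑u⁻¹ : A) * (algebraMap ℂ A w - a) = 1 := by rw [← hu, Units.inv_mul]
  set b : A := ↑u⁻¹
  obtain ⟨δ, hδ, hδb⟩ : ∃ δ : ℝ, 0 < δ ∧ ‖b‖ * (c * (2 * δ)) ≤ 1 / 2 := by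
    have hM : 0 < 4 * (‖b‖ * c) + 1 := by positivity
    refine ⟨1 / (4 * (‖b‖ * c) + 1), by positivity, ?_⟩
    have : ‖b‖ * (c * (2 * (1 / (4 * (‖b‖ * c) + 1)))) =
        (2 * (‖b‖ * c)) / (4 * (‖b‖ * c) + 1) := by ring
    rw [this, div_le_iff₀ hM]
    linarith
  have hhalf : CircleBound a (tent w δ) (1 / 2) := by
    intro ε hε
    obtain ⟨p, k, hp, hp'⟩ :=
      circleBound_tent ha hc (mem_sphere_zero_iff_norm.1 w.2) hb hδ ε hε
    exact ⟨p, k, hp, hp'.mono (by linarith)⟩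
  have hmul : tent w δ * tent w (δ / 2) = tent w (δ / 2) := by
    ext z
    rcases le_total ‖(w : ℂ) - z‖ δ with h | h
    · simp [tent_eq_one hδ h]
    · simp [tent_eq_zero (half_pos hδ) (show 2 * (δ / 2) ≤ ‖(w : ℂ) - z‖ by linarith)]
  have hpow : ∀ j : ℕ, CircleBound a (tent w (δ / 2)) ((1 / 2) ^ j * (c * 1)) := by
    intro j
    induction j with
    | zero =>
      simpa using CircleBound.of_norm_le ha hc zero_le_one (tent_norm_le (w : ℂ) (δ / 2))
    | succ j ih =>
      have := hhalf.mul ih (by norm_num) (by positivity)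
      rwa [hmul, ← mul_assoc, ← pow_succ'] at this
  refine ⟨tent w (δ / 2), CircleBound.zero_of_forall fun ε hε => ?_, ?_⟩
  · have hlim : Tendsto (fun j : ℕ => (1 / 2 : ℝ) ^ j * (c * 1)) atTop (𝓝 (0 * (c * 1))) :=
      (tendsto_pow_atTop_nhds_zero_of_lt_one (by norm_num) (by norm_num)).mul_const _
    rw [zero_mul] at hlim
    obtain ⟨j, hj⟩ := (hlim.eventually_le_const hε).exists
    exact ⟨_, hj, hpow j⟩
  · rw [tent_eq_one (half_pos hδ) (by rw [sub_self, norm_zero]; positivity)]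
    exact one_ne_zero

/-- A closed ideal of `C(𝕋)` contains every function that vanishes on its common zeros. -/
lemma circleBound_zero_of_vanish (ha : CircleDominated a c) (hc : 0 ≤ c)
    (hg : ∀ z : Metric.sphere (0 : ℂ) 1, (z : ℂ) ∈ spectrum ℂ a → g z = 0) :
    CircleBound a g 0 := by
  rw [← mem_nullIdeal (ha := ha) (hc := hc),
    ← ContinuousMap.idealOfSet_ofIdeal_isClosed (isClosed_nullIdeal ha hc),
    ContinuousMap.mem_idealOfSet]
  intro z hz
  refine hg z (by_contra fun hzs => hz ?_)
  exact ContinuousMap.mem_setOfIdeal.2 (exists_mem_nullIdeal_ne_zero ha hc z hzs)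

/-- On polynomials, asymptotic bounds only see the spectrum on the unit circle. -/
lemma AsympBound.of_norm_le_on_spectrum (ha : CircleDominated a c) (hc : 0 ≤ c) {ε : ℝ}
    (hε : 0 < ε)
    (hp : ∀ z : Metric.sphere (0 : ℂ) 1, (z : ℂ) ∈ spectrum ℂ a → ‖p.eval (z : ℂ)‖ ≤ ε) :
    AsympBound a p ((2 * c + 1) * ε) := by
  -- `g` is `p` with its values truncated to the disc of radius `ε`.
  let g : C(Metric.sphere (0 : ℂ) 1, ℂ) :=
    { toFun := fun z => ((ε / max ε ‖p.eval (z : ℂ)‖ : ℝ) : ℂ) * p.eval (z : ℂ)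
      continuous_toFun := by
        refine Continuous.mul (Complex.continuous_ofReal.comp ?_) (by fun_prop)
        exact Continuous.div (by fun_prop) (by fun_prop)
          fun z => (hε.trans_le (le_max_left _ _)).ne' }
  have hgn : ∀ z, ‖g z‖ ≤ ε := by
    intro z
    have hm : 0 < max ε ‖p.eval (z : ℂ)‖ := hε.trans_le (le_max_left _ _)
    change ‖((ε / max ε ‖p.eval (z : ℂ)‖ : ℝ) : ℂ) * p.eval (z : ℂ)‖ ≤ ε
    rw [norm_mul, Complex.norm_real, Real.norm_of_nonneg (by positivity), div_mul_eq_mul_div,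
      div_le_iff₀ hm]
    gcongr
    exact le_max_right _ _
  have hgp : ∀ z : Metric.sphere (0 : ℂ) 1, (z : ℂ) ∈ spectrum ℂ a → g z = p.eval (z : ℂ) := by
    intro z hz
    change ((ε / max ε ‖p.eval (z : ℂ)‖ : ℝ) : ℂ) * p.eval (z : ℂ) = _
    rw [max_eq_left (hp z hz), div_self hε.ne', Complex.ofReal_one, one_mul]
  obtain ⟨q, k, hq, hq'⟩ := circleBound_zero_of_vanish ha hc
    (g := p.toContinuousMapOn _ - g) (fun z hz => by simp [hgp z hz]) ε hε
  have hrest := ha (X ^ k * p - q) (2 * ε) (by positivity) fun z => by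
    have e : (X ^ k * p - q).eval (z : ℂ) =
        (z : ℂ) ^ k * g z +
          ((z : ℂ) ^ k * (p.toContinuousMapOn (Metric.sphere 0 1) - g) z - q.eval (z : ℂ)) := by
      simp only [eval_sub, eval_mul, eval_pow, eval_X, ContinuousMap.sub_apply,
        toContinuousMapOn_apply, toContinuousMap_apply]
      ring
    rw [e, two_mul]
    refine (norm_add_le _ _).trans (add_le_add ?_ (hq z))
    rw [norm_mul, norm_pow_coe_sphere, one_mul]
    exact hgn z
  have hsum := hrest.add hq'
  rw [sub_add_cancel] at hsum
  exact hsum.of_X_pow_mul.mono (by linarith)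

end Asymptotic

/-! ### The Besov norm of `zⁿ f` -/

/-- The integrand `sup_{|θ| ≤ π} |F'(r e^{iθ})|` of the Besov seminorm. -/
noncomputable def circleSup (F : ℂ → ℂ) (r : ℝ) : ℝ≥0∞ :=
  ⨆ θ ∈ Set.Icc (-Real.pi) Real.pi, ‖deriv F (r * Complex.exp (θ * Complex.I))‖ₑ

lemma lintegral_pow_mul_tendsto {F : ℂ → ℂ} (hF : DifferentiableOn ℂ F (Metric.ball 0 1))
    (hfin : seminormE F ≠ ∞) :
    Tendsto (fun n : ℕ => ∫⁻ r in Set.Ioo (0 : ℝ) 1, ENNReal.ofReal (r ^ n) * circleSup F r)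
      atTop (𝓝 0) := by
  have hmeas : AEMeasurable (circleSup F) (MeasureTheory.volume.restrict (Set.Ioo (0 : ℝ) 1)) :=
    aemeasurable_sup hF
  have h := MeasureTheory.tendsto_lintegral_of_dominated_convergence'
    (μ := MeasureTheory.volume.restrict (Set.Ioo (0 : ℝ) 1))
    (F := fun (n : ℕ) r => ENNReal.ofReal (r ^ n) * circleSup F r) (f := fun _ => 0)
    (circleSup F) ?_ ?_ hfin ?_
  · simpa using h
  · intro n
    exact AEMeasurable.mul (by fun_prop) hmeas
  · intro n
    filter_upwards [MeasureTheory.ae_restrict_mem measurableSet_Ioo] with r hr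
    refine mul_le_of_le_one_left' ?_
    rw [ENNReal.ofReal_le_one]
    exact pow_le_one₀ hr.1.le hr.2.le
  · filter_upwards [MeasureTheory.ae_restrict_mem measurableSet_Ioo,
      MeasureTheory.ae_lt_top' hmeas hfin] with r hr hlt
    have h1 : Tendsto (fun n : ℕ => ENNReal.ofReal (r ^ n)) atTop (𝓝 0) := by
      simpa using ENNReal.tendsto_ofReal (tendsto_pow_atTop_nhds_zero_of_lt_one hr.1.le hr.2)
    simpa using ENNReal.Tendsto.mul_const h1 (Or.inr hlt.ne)

lemma lintegral_nat_mul_pow (n : ℕ) :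
    ∫⁻ r in Set.Ioo (0 : ℝ) 1, ENNReal.ofReal ((n + 1 : ℕ) * r ^ n) = 1 := by
  have hint : MeasureTheory.IntegrableOn (fun r : ℝ => ((n + 1 : ℕ) : ℝ) * r ^ n)
      (Set.Ioo (0 : ℝ) 1) :=
    (Continuous.integrableOn_Icc (by fun_prop)).mono_set Set.Ioo_subset_Icc_self
  rw [← MeasureTheory.ofReal_integral_eq_lintegral_ofReal hint,
    ← MeasureTheory.integral_Ioc_eq_integral_Ioo,
    ← intervalIntegral.integral_of_le zero_le_one, intervalIntegral.integral_const_mul,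
    integral_pow]
  · have : ((n : ℝ) + 1) ≠ 0 := by positivity
    simp [this]
  · filter_upwards [MeasureTheory.ae_restrict_mem measurableSet_Ioo] with r hr
    have := hr.1.le
    simp only [Pi.zero_apply]
    positivity

lemma coe_besovCoord_pow_mul (f : BesovAlgebra) (n : ℕ) (z : 𝔻) :
    ((besovCoord ^ n * f : BesovAlgebra) : 𝔻 → ℂ) z = (z : ℂ) ^ n * (f : 𝔻 → ℂ) z := rfl

/-- The first term of the product rule for `zⁿ f` contributes `s` to the seminorm, because
`∫₀¹ n rⁿ⁻¹ dr = 1`. -/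
lemma seminormE_coord_pow_mul_le (f : BesovAlgebra) {s : ℝ}
    (hf : ∀ z : 𝔻, ‖(f : 𝔻 → ℂ) z‖ ≤ s) (n : ℕ) :
    seminormE (toPlane (besovCoord ^ (n + 1) * f : BesovAlgebra)) ≤ ENNReal.ofReal s +
      ∫⁻ r in Set.Ioo (0 : ℝ) 1,
        ENNReal.ofReal (r ^ (n + 1)) * circleSup (toPlane (f : 𝔻 → ℂ)) r := by
  set F := toPlane (f : 𝔻 → ℂ) with hFdef
  have hF : DifferentiableOn ℂ F (Metric.ball 0 1) := f.2.1
  have hFs : ∀ z ∈ Metric.ball (0 : ℂ) 1, ‖F z‖ ≤ s := by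
    intro z hz
    rw [hFdef, ← Complex.UnitDisc.coe_mk z (mem_ball_zero_iff.1 hz), toPlane_coe]
    exact hf _
  have hmeas : AEMeasurable (circleSup F) (MeasureTheory.volume.restrict (Set.Ioo (0 : ℝ) 1)) :=
    aemeasurable_sup hF
  have h1 : ENNReal.ofReal s =
      ∫⁻ r in Set.Ioo (0 : ℝ) 1, ENNReal.ofReal ((n + 1 : ℕ) * r ^ n) * ENNReal.ofReal s := by
    rw [MeasureTheory.lintegral_mul_const' _ _ ENNReal.ofReal_ne_top, lintegral_nat_mul_pow,
      one_mul]
  rw [h1, ← MeasureTheory.lintegral_add_left (by fun_prop), seminormE]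
  refine MeasureTheory.setLIntegral_mono' measurableSet_Ioo fun r hr => ?_
  refine iSup₂_le fun θ hθ => ?_
  have hmem := polar_mem hr θ
  have hnorm := norm_polar hr θ
  set z : ℂ := r * Complex.exp (θ * Complex.I) with hz
  have hev : toPlane (besovCoord ^ (n + 1) * f : BesovAlgebra) =ᶠ[𝓝 z]
      fun w => w ^ (n + 1) * F w := by
    filter_upwards [Metric.isOpen_ball.mem_nhds hmem] with w hw
    have hw' := mem_ball_zero_iff.1 hw
    simp [toPlane, hFdef, hw', coe_besovCoord_pow_mul]
  have hFz : HasDerivAt F (deriv F z) z :=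
    (hF.differentiableAt (Metric.isOpen_ball.mem_nhds hmem)).hasDerivAt
  have hd := ((hasDerivAt_pow (n + 1) z).fun_mul hFz).deriv
  rw [hev.deriv_eq]
  have hd' : deriv (fun w => w ^ (n + 1) * F w) z =
      ((n + 1 : ℕ) : ℂ) * z ^ n * F z + z ^ (n + 1) * deriv F z := by
    simpa using hd
  rw [hd']
  refine (enorm_add_le _ _).trans (add_le_add ?_ ?_)
  · rw [enorm_mul]
    gcongr
    · rw [← ofReal_norm, norm_mul, norm_pow, hnorm, Complex.norm_natCast]
    · rw [← ofReal_norm]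
      exact ENNReal.ofReal_le_ofReal (hFs z hmem)
  · rw [enorm_mul]
    gcongr
    · rw [← ofReal_norm, norm_pow, hnorm]
    · exact le_iSup₂ (f := fun (θ : ℝ) (_ : θ ∈ Set.Icc (-Real.pi) Real.pi) =>
        ‖deriv F (r * Complex.exp (θ * Complex.I))‖ₑ) θ hθ

lemma eventually_besovNorm_coord_pow_mul_le (f : BesovAlgebra) {s ε : ℝ} (hε : 0 < ε)
    (hf : ∀ z : 𝔻, ‖(f : 𝔻 → ℂ) z‖ ≤ s) :
    ∀ᶠ n : ℕ in atTop, besovNorm (besovCoord ^ n * f) ≤ 2 * s + ε := by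
  have hs : 0 ≤ s := (norm_nonneg _).trans (hf 0)
  have hev := (lintegral_pow_mul_tendsto f.2.1 f.2.2.ne).eventually_le_const (ENNReal.ofReal_pos.2 hε)
  filter_upwards [hev, eventually_ge_atTop 1] with m hn hm
  obtain ⟨n, rfl⟩ := Nat.exists_eq_add_of_le' hm
  have h1 : (⨆ z : 𝔻, ‖((besovCoord ^ (n + 1) * f : BesovAlgebra) : 𝔻 → ℂ) z‖) ≤ s := by
    refine ciSup_le fun z => ?_
    rw [coe_besovCoord_pow_mul, norm_mul, norm_pow]
    exact (mul_le_of_le_one_left (norm_nonneg _)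
      (pow_le_one₀ (norm_nonneg _) z.norm_lt_one.le)).trans (hf z)
  have h2 : (seminormE (toPlane (besovCoord ^ (n + 1) * f : BesovAlgebra))).toReal ≤ s + ε := by
    refine ENNReal.toReal_le_of_le_ofReal (by linarith) ?_
    rw [ENNReal.ofReal_add hs hε.le]
    refine (seminormE_coord_pow_mul_le f hf n).trans ?_
    gcongr
  rw [besovNorm]
  linarith

/-! ### Polynomial approximation in the Besov algebra -/

lemma coe_aeval_besovCoord (p : ℂ[X]) (z : 𝔻) :
    ((aeval besovCoord p : BesovAlgebra) : 𝔻 → ℂ) z = p.eval (z : ℂ) := by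
  let e : BesovAlgebra →ₐ[ℂ] ℂ := (Pi.evalAlgHom ℂ (fun _ : 𝔻 => ℂ) z).comp BesovAlgebra.val
  have h := (aeval_algHom_apply e besovCoord p).symm
  rw [← coe_aeval_eq_eval]
  exact h

/-- The oscillation of `F` along a radius is at most the integral of `sup_θ |F'(r e^{iθ})|`. -/
lemma enorm_sub_mul_le {F : ℂ → ℂ} (hF : DifferentiableOn ℂ F (Metric.ball 0 1)) {z : ℂ}
    (hz : ‖z‖ < 1) {ρ : ℝ} (hρ : ρ ∈ Set.Icc (0 : ℝ) 1) :
    ‖F z - F (ρ * z)‖ₑ ≤ ∫⁻ r in Set.Ioc (ρ * ‖z‖) ‖z‖, circleSup F r := by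
  set u : ℂ := Complex.exp (z.arg * Complex.I) with hu
  have hzu : (‖z‖ : ℂ) * u = z := Complex.norm_mul_exp_arg_mul_I z
  have hun : ‖u‖ = 1 := Complex.norm_exp_ofReal_mul_I _
  have hle : ρ * ‖z‖ ≤ ‖z‖ := mul_le_of_le_one_left (norm_nonneg z) hρ.2
  have h0 : 0 ≤ ρ * ‖z‖ := mul_nonneg hρ.1 (norm_nonneg z)
  have hmem : ∀ t ∈ Set.uIcc (ρ * ‖z‖) ‖z‖, (t : ℂ) * u ∈ Metric.ball (0 : ℂ) 1 := by
    intro t ht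
    rw [Set.uIcc_of_le hle] at ht
    rw [mem_ball_zero_iff, norm_mul, hun, mul_one, Complex.norm_real,
      Real.norm_of_nonneg (h0.trans ht.1)]
    exact ht.2.trans_lt hz
  have hder : ∀ t ∈ Set.uIcc (ρ * ‖z‖) ‖z‖,
      HasDerivAt (fun t : ℝ => F (t * u)) (deriv F (t * u) * u) t := by
    intro t ht
    have h1 : HasDerivAt F (deriv F (t * u)) ((t : ℂ) * u) :=
      (hF.differentiableAt (Metric.isOpen_ball.mem_nhds (hmem t ht))).hasDerivAt
    have h2 : HasDerivAt (fun s : ℂ => s * u) u (t : ℂ) := by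
      simpa using (hasDerivAt_id (t : ℂ)).mul_const u
    exact (h1.comp (t : ℂ) h2).comp_ofReal
  have hcont : ContinuousOn (fun t : ℝ => deriv F (t * u) * u) (Set.uIcc (ρ * ‖z‖) ‖z‖) :=
    ((deriv_continuousOn hF).comp (by fun_prop) hmem).mul continuousOn_const
  have hint := intervalIntegral.integral_eq_sub_of_hasDerivAt hder hcont.intervalIntegrable
  rw [Complex.ofReal_mul, mul_assoc, hzu] at hint
  rw [← hint, intervalIntegral.integral_of_le hle]
  refine (MeasureTheory.enorm_integral_le_lintegral_enorm _).trans ?_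
  refine MeasureTheory.lintegral_mono fun t => ?_
  have hu1 : ‖u‖ₑ = 1 := by rw [← ofReal_norm, hun, ENNReal.ofReal_one]
  simp only [enorm_mul, hu1, mul_one]
  exact le_iSup₂ (f := fun (θ : ℝ) (_ : θ ∈ Set.Icc (-Real.pi) Real.pi) =>
    ‖deriv F (t * Complex.exp (θ * Complex.I))‖ₑ) z.arg
    ⟨(Complex.neg_pi_lt_arg z).le, Complex.arg_le_pi z⟩

/-- Dilations converge uniformly on the disc, by absolute continuity of the integral. -/
lemma exists_dilation_near {F : ℂ → ℂ} (hF : DifferentiableOn ℂ F (Metric.ball 0 1))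
    (hfin : seminormE F ≠ ∞) {ε : ℝ} (hε : 0 < ε) :
    ∃ ρ ∈ Set.Ioo (0 : ℝ) 1, ∀ z : ℂ, ‖z‖ < 1 → ‖F z - F (ρ * z)‖ ≤ ε := by
  obtain ⟨δ, hδ, h⟩ := MeasureTheory.exists_pos_setLIntegral_lt_of_measure_lt
    (μ := MeasureTheory.volume.restrict (Set.Ioo (0 : ℝ) 1)) (f := circleSup F) hfin
    (ENNReal.ofReal_pos.2 hε).ne'
  have hlim : Tendsto (fun ρ : ℝ => ENNReal.ofReal (1 - ρ)) (𝓝[<] 1) (𝓝 0) := by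
    have : Tendsto (fun ρ : ℝ => ENNReal.ofReal (1 - ρ)) (𝓝 1) (𝓝 (ENNReal.ofReal (1 - 1))) :=
      (ENNReal.continuous_ofReal.comp (by fun_prop : Continuous fun ρ : ℝ => 1 - ρ)).tendsto 1
    simpa using this.mono_left nhdsWithin_le_nhds
  obtain ⟨ρ, hρδ, hρ⟩ := ((hlim.eventually_lt_const hδ).and
    (Ioo_mem_nhdsLT (zero_lt_one (α := ℝ)))).exists
  refine ⟨ρ, hρ, fun z hz => ?_⟩
  have h0 : 0 ≤ ρ * ‖z‖ := mul_nonneg hρ.1.le (norm_nonneg z)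
  have hsub : Set.Ioc (ρ * ‖z‖) ‖z‖ ⊆ Set.Ioo (0 : ℝ) 1 :=
    fun t ht => ⟨h0.trans_lt ht.1, ht.2.trans_lt hz⟩
  have hres : (MeasureTheory.volume.restrict (Set.Ioo (0 : ℝ) 1)).restrict
      (Set.Ioc (ρ * ‖z‖) ‖z‖) = MeasureTheory.volume.restrict (Set.Ioc (ρ * ‖z‖) ‖z‖) :=
    MeasureTheory.Measure.restrict_restrict_of_subset hsub
  have hlt := h (Set.Ioc (ρ * ‖z‖) ‖z‖) <| by
    refine (MeasureTheory.Measure.restrict_apply_le _ _).trans_lt ?_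
    rw [Real.volume_Ioc]
    refine lt_of_le_of_lt (ENNReal.ofReal_le_ofReal ?_) hρδ
    nlinarith [hρ.2]
  rw [hres] at hlt
  have hfinal := (enorm_sub_mul_le hF hz ⟨hρ.1.le, hρ.2.le⟩).trans hlt.le
  rw [← ofReal_norm] at hfinal
  exact (ENNReal.ofReal_le_ofReal_iff hε.le).1 hfinal

/-- Taylor polynomials of a dilation. -/
lemma exists_polynomial_near_dilation {F : ℂ → ℂ}
    (hF : DifferentiableOn ℂ F (Metric.ball 0 1)) {ρ : ℝ} (hρ : ρ ∈ Set.Ioo (0 : ℝ) 1) {ε : ℝ}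
    (hε : 0 < ε) :
    ∃ p : ℂ[X], ∀ z : ℂ, ‖z‖ < 1 → ‖F (ρ * z) - p.eval z‖ ≤ ε := by
  obtain ⟨R, hρR, hR⟩ := exists_between hρ.2
  lift R to NNReal using (hρ.1.trans hρR).le
  lift ρ to NNReal using hρ.1.le
  have hR0 : 0 < R := by exact_mod_cast hρ.1.trans hρR
  have hps := (hF.mono (Metric.closedBall_subset_ball hR)).hasFPowerSeriesOnBall hR0
  set P := cauchyPowerSeries F 0 R
  have hunif := hps.tendstoUniformlyOn (r' := ρ) (by exact_mod_cast hρR)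
  obtain ⟨N, hN⟩ := (Metric.tendstoUniformlyOn_iff.1 hunif ε hε).exists
  refine ⟨∑ k ∈ Finset.range N, C (P.coeff k * (ρ : ℂ) ^ k) * X ^ k, fun z hz => ?_⟩
  have hmem : ((ρ : ℝ) : ℂ) * z ∈ Metric.ball (0 : ℂ) ρ := by
    rw [mem_ball_zero_iff, norm_mul, Complex.norm_real, Real.norm_of_nonneg hρ.1.le]
    exact mul_lt_of_lt_one_right hρ.1 hz
  have h := (hN _ hmem).le
  rw [dist_eq_norm, zero_add] at h
  convert! h using 3
  rw [FormalMultilinearSeries.partialSum, eval_finsetSum]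
  refine Finset.sum_congr rfl fun k _ => ?_
  rw [FormalMultilinearSeries.apply_eq_pow_smul_coeff]
  simp only [eval_mul, eval_C, eval_pow, eval_X, smul_eq_mul, mul_pow]
  ring

lemma exists_polynomial_near_besov (f : BesovAlgebra) {ε : ℝ} (hε : 0 < ε) :
    ∃ p : ℂ[X], ∀ z : ℂ, ‖z‖ < 1 → ‖toPlane f z - p.eval z‖ ≤ ε := by
  obtain ⟨ρ, hρ, h1⟩ := exists_dilation_near f.2.1 f.2.2.ne (half_pos hε)
  obtain ⟨p, h2⟩ := exists_polynomial_near_dilation f.2.1 hρ (half_pos hε)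
  refine ⟨p, fun z hz => ?_⟩
  calc ‖toPlane f z - p.eval z‖
      = ‖(toPlane f z - toPlane f (ρ * z)) + (toPlane f (ρ * z) - p.eval z)‖ := by
        rw [sub_add_sub_cancel]
    _ ≤ ε / 2 + ε / 2 := (norm_add_le _ _).trans (add_le_add (h1 z hz) (h2 z hz))
    _ = ε := add_halves ε

/-! ### Operators with a bounded Besov calculus -/

section Calculus

variable {Y : Type*} [NormedAddCommGroup Y] [NormedSpace ℂ Y] {T : Y →L[ℂ] Y}

/-- The asymptotic size of `Tⁿ f(T)` only sees the supremum norm of `f`. -/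
lemma exists_calculus_bound (Φ : BoundedBesovCalculus T) :
    ∃ c : ℝ, 0 ≤ c ∧ ∀ (f : BesovAlgebra) (s : ℝ), 0 < s → (∀ z : 𝔻, ‖(f : 𝔻 → ℂ) z‖ ≤ s) →
      ∀ᶠ n : ℕ in atTop, ‖T ^ n * Φ.toAlgHom f‖ ≤ c * s := by
  obtain ⟨K, hK⟩ := Φ.bounded
  refine ⟨3 * |K|, by positivity, fun f s hs hf => ?_⟩
  filter_upwards [eventually_besovNorm_coord_pow_mul_le f hs hf] with n hn
  have h0 : 0 ≤ besovNorm (besovCoord ^ n * f) :=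
    add_nonneg (Real.iSup_nonneg fun _ => norm_nonneg _) ENNReal.toReal_nonneg
  have e : T ^ n * Φ.toAlgHom f = Φ.toAlgHom (besovCoord ^ n * f) := by
    rw [map_mul, map_pow, Φ.map_coord]
  rw [e]
  calc ‖Φ.toAlgHom (besovCoord ^ n * f)‖ ≤ K * besovNorm (besovCoord ^ n * f) := hK _
    _ ≤ |K| * besovNorm (besovCoord ^ n * f) := by
        gcongr
        exact le_abs_self K
    _ ≤ |K| * (2 * s + s) := by gcongr
    _ = 3 * |K| * s := by ring

lemma calculus_aeval (Φ : BoundedBesovCalculus T) (p : ℂ[X]) :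
    Φ.toAlgHom (aeval besovCoord p) = aeval T p := by
  rw [← aeval_algHom_apply, Φ.map_coord]

lemma norm_eval_le_of_sphere {p : ℂ[X]} {δ : ℝ}
    (hp : ∀ z : Metric.sphere (0 : ℂ) 1, ‖p.eval (z : ℂ)‖ ≤ δ) {z : ℂ} (hz : ‖z‖ < 1) :
    ‖p.eval z‖ ≤ δ := by
  refine Complex.norm_le_of_forall_mem_frontier_norm_le (f := fun z => p.eval z)
    (Metric.isBounded_ball (x := (0 : ℂ)) (r := 1)) p.differentiable.diffContOnCl ?_
    (subset_closure (mem_ball_zero_iff.2 hz))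
  intro w hw
  rw [frontier_ball _ one_ne_zero] at hw
  exact hp ⟨w, hw⟩

/-- A bounded Besov calculus makes `f(T)` vanish asymptotically along the powers of `T`, as soon as
`f` vanishes on the unitary spectrum. -/
theorem tendsto_norm_pow_mul_calculus (Φ : BoundedBesovCalculus T) (f : BesovAlgebra)
    (hf : ∀ ζ ∈ unitarySpectrum T, HasBoundaryValue f ζ 0) :
    Tendsto (fun n : ℕ => ‖T ^ n * Φ.toAlgHom f‖) atTop (𝓝 0) := by
  obtain ⟨c, hc, hbound⟩ := exists_calculus_bound Φ
  have haeval : ∀ (p : ℂ[X]) (n : ℕ),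
      T ^ n * Φ.toAlgHom (aeval besovCoord p) = aeval T (X ^ n * p) := by
    intro p n
    rw [calculus_aeval, map_mul, map_pow, aeval_X]
  have hdom : CircleDominated T c := by
    intro p δ hδ hp
    filter_upwards [hbound (aeval besovCoord p) δ hδ fun z => by
      rw [coe_aeval_besovCoord]
      exact norm_eval_le_of_sphere hp z.norm_lt_one] with n hn
    rwa [haeval] at hn
  have main : ∀ η > 0, ∀ᶠ n : ℕ in atTop, ‖T ^ n * Φ.toAlgHom f‖ ≤ (3 * c + 1) * η := by
    intro η hη
    obtain ⟨p, hp⟩ := exists_polynomial_near_besov f hη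
    have hspec : ∀ z : Metric.sphere (0 : ℂ) 1, (z : ℂ) ∈ spectrum ℂ T →
        ‖p.eval (z : ℂ)‖ ≤ η := by
      intro z hz
      have h1 : Tendsto (fun r : ℝ => toPlane f (r * z)) (𝓝[<] 1) (𝓝 0) := hf z ⟨hz, z.2⟩
      have h2 : Tendsto (fun r : ℝ => p.eval ((r : ℂ) * z)) (𝓝[<] 1) (𝓝 (p.eval (z : ℂ))) := by
        have hcont : Continuous fun r : ℝ => p.eval ((r : ℂ) * z) :=
          p.continuous.comp (by fun_prop)
        simpa using (hcont.tendsto 1).mono_left nhdsWithin_le_nhds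
      have h3 := (h1.sub h2).norm
      rw [zero_sub, norm_neg] at h3
      refine le_of_tendsto h3 ?_
      filter_upwards [Ioo_mem_nhdsLT (zero_lt_one (α := ℝ))] with r hr
      refine hp _ ?_
      rw [norm_mul, mem_sphere_zero_iff_norm.1 z.2, mul_one, Complex.norm_real,
        Real.norm_of_nonneg hr.1.le]
      exact hr.2
    have hpoly := AsympBound.of_norm_le_on_spectrum hdom hc hη hspec
    have hdiff := hbound (f - aeval besovCoord p) η hη fun z => by
      have h := hp z z.norm_lt_one
      rwa [toPlane_coe, ← coe_aeval_besovCoord] at h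
    filter_upwards [hpoly, hdiff] with n h1 h2
    have e : T ^ n * Φ.toAlgHom f =
        T ^ n * Φ.toAlgHom (f - aeval besovCoord p) + aeval T (X ^ n * p) := by
      rw [← haeval, ← mul_add, ← map_add, sub_add_cancel]
    rw [e]
    exact (norm_add_le _ _).trans ((add_le_add h2 h1).trans (by linarith))
  rw [Metric.tendsto_nhds]
  intro ε hε
  filter_upwards [main (ε / (2 * (3 * c + 1))) (by positivity)] with n hn
  rw [Real.dist_0_eq_abs, abs_of_nonneg (norm_nonneg _)]
  refine hn.trans_lt ?_
  have e : (3 * c + 1) * (ε / (2 * (3 * c + 1))) = ε / 2 := by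
    have : 3 * c + 1 ≠ 0 := by positivity
    field_simp
  rw [e]
  exact half_lt_self hε

end Calculus

end KatznelsonTzafriri

theorem theorem2p7 {X : Type*} [NormedAddCommGroup X] [NormedSpace ℂ X] [CompleteSpace X]
    (T : X →L[ℂ] X) (hT : IsPowerBounded T) (Φ : BoundedBesovCalculus T)
    (f : BesovAlgebra) (hf : ∀ ζ ∈ unitarySpectrum T, HasBoundaryValue f ζ 0) :
    Tendsto (fun n : ℕ => ‖T ^ n * Φ.toAlgHom f‖) atTop (𝓝 0) :=
  KatznelsonTzafriri.tendsto_norm_pow_mul_calculus Φ f hf
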